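/- Let $G$ be a compact Lie group (not necessarily connected) of dimension $n$, with Lie algebra $\mathfrak g = T_eG$, and let $m$ be a left-invariant smooth Riemannian metric on $G$, i.e. a metric preserved by all left translations $L_g : h \mapsto gh$. Let $A_g : T_gG \to T_g^*G$, $A_g v = m_g(v,\cdot)$, and let $$H : T^*G \to \mathbb R, \qquad H(g,p) = \tfrac12 \langle p, A_g^{-1} p\rangle$$ be the Hamiltonian of the geodesic flow of $m$. Equip $T^*G$ with its canonical symplectic form $\omega = -d(p\,dx)$; for $f, g\in C^1(T^*G)$ let $X_f$ be the Hamiltonian vector field given by $\omega(X_f,\cdot)=df$, and $\{f,g\} = \omega(X_f,X_g)$. Call a $C^1$ function $F$ an integral of motion of $H$ if $\{H,F\}\equiv 0$ on $T^*G$. Then: 1. $H$ is a Tonelli Hamiltonian: it is of class $C^2$, strictly convex in each fibre (with positive definite fibrewise Hessian), and uniformly superlinear in the fibres, i.e. for every $K \ge 0$ there is $C\in\mathbb R$ with $H(g,p) \ge K\|p\|_g - C$ for all $(g,p)\in T^*G$, where $\|\cdot\|$ is the dual norm of some (equivalently, since $G$ is compact, any) Riemannian metric on $G$. 2. $H$ is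 weakly integrable: there exist $n$ integrals of motion of $H$ of class $C^2$ whose differentials are linearly independent at every point of $T^*G$. 3. More precisely, for $(g,p)\in T^*G$ let $p_s = R_g^*p \in \mathfrak g^*$ be the angular momentum relative to the space, i.e. $\langle p_s, a\rangle = \langle p, (dR_g)_e a\rangle$ for $a\in\mathfrak g$, where $R_g : h\mapsto hg$. For every basis $a_1,\dots,a_n$ of $\mathfrak g$, the components $F_i(g,p) = \langle p_s, a_i\rangle$, $i=1,\dots,n$, of $p_s$ are integrals of motion of $H$ of class $C^2$ whose differentials are linearly independent at every point of $T^*G$. -/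

import Mathlib

open scoped Manifold ContDiff
open Bundle

noncomputable section

/-! ### The cotangent bundle and its canonical symplectic form

Throughout, `M` is a smooth manifold without boundary modelled on the finite-dimensional real
vector space `E`, so that `n = dim M = Module.finrank ℝ E`. -/

section Cotangent

variable (E M : Type*) [NormedAddCommGroup E] [NormedSpace ℝ E]
  [TopologicalSpace M] [ChartedSpace E M] [IsManifold 𝓘(ℝ, E) ∞ M]

/-- The cotangent bundle `T*M`; its points are pairs `⟨x, p⟩` with `p : T_x M →L[ℝ] ℝ`. The topology
and the smooth structure are those which Mathlib puts on the bundle of continuous linear maps from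
the tangent bundle to the trivial line bundle. -/
abbrev CotangentBundle : Type _ :=
  TotalSpace (E →L[ℝ] ℝ) (fun x : M => TangentSpace 𝓘(ℝ, E) x →L[ℝ] ℝ)

/-- The model with corners of `T*M` (with model vector space `E × E*`, of dimension `2 n`). -/
abbrev cotangentModel (E : Type*) [NormedAddCommGroup E] [NormedSpace ℝ E] :
    ModelWithCorners ℝ (E × (E →L[ℝ] ℝ)) (ModelProd E (E →L[ℝ] ℝ)) :=
  𝓘(ℝ, E).prod 𝓘(ℝ, E →L[ℝ] ℝ)

variable {E M}

/-- The tautological (Liouville) 1-form `p dx` on `T*M`: `θ_(x,p)(X) = p (dπ X)`, where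
`π : T*M → M` is the projection. -/
def tautologicalForm (ξ : CotangentBundle E M) :
    TangentSpace (cotangentModel E) ξ →L[ℝ] ℝ :=
  ξ.2.comp (mfderiv (cotangentModel E) 𝓘(ℝ, E) (fun η : CotangentBundle E M => η.proj) ξ)

/-- The expression of the tautological 1-form in the chart of `T*M` around `ξ`, i.e. its pullback
by the inverse of that chart, a 1-form on (an open subset of) `E × E*`. -/
def tautologicalFormInChart (ξ : CotangentBundle E M) (z : E × (E →L[ℝ] ℝ)) :
    (E × (E →L[ℝ] ℝ)) [⋀^Fin 1]→L[ℝ] ℝ :=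
  ContinuousAlternatingMap.ofSubsingleton ℝ (E × (E →L[ℝ] ℝ)) ℝ (0 : Fin 1)
    ((tautologicalForm ((extChartAt (cotangentModel E) ξ).symm z)).comp
      (mfderiv 𝓘(ℝ, E × (E →L[ℝ] ℝ)) (cotangentModel E)
        (extChartAt (cotangentModel E) ξ).symm z))

/-- The canonical symplectic form `ω = - dθ` (`= dx ∧ dp`) of `T*M`. The exterior derivative at `ξ`
is computed in the chart around `ξ` and pulled back to `T*M` by that chart. -/
def canonicalSymplecticForm (ξ : CotangentBundle E M) :
    TangentSpace (cotangentModel E) ξ [⋀^Fin 2]→L[ℝ] ℝ :=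
  -((extDeriv (tautologicalFormInChart ξ)
      (extChartAt (cotangentModel E) ξ ξ)).compContinuousLinearMap
        (mfderiv (cotangentModel E) 𝓘(ℝ, E × (E →L[ℝ] ℝ)) (extChartAt (cotangentModel E) ξ) ξ))

/-- The chart of `T*M` around `ξ` covers the chart of `M` around the base point of `ξ`. -/
lemma extChartAt_cotangent_fst (ξ η : CotangentBundle E M) :
    (extChartAt (cotangentModel E) ξ η).1 = extChartAt 𝓘(ℝ, E) ξ.proj η.proj := by
  rw [FiberBundle.extChartAt]
  simp [hom_trivializationAt_apply]

lemma proj_mem_source_of_mem_source {ξ η : CotangentBundle E M}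
    (h : η ∈ (extChartAt (cotangentModel E) ξ).source) :
    η.proj ∈ (chartAt E ξ.proj).source := by
  rw [FiberBundle.extChartAt] at h
  simpa using h.1

/-- The fibre component of the chart of `T*M` around `ξ`. -/
lemma extChartAt_cotangent_snd {ξ η : CotangentBundle E M}
    (h : η ∈ (extChartAt (cotangentModel E) ξ).source) (w : E) :
    (extChartAt (cotangentModel E) ξ η).2 w =
      η.2 (mfderiv 𝓘(ℝ, E) 𝓘(ℝ, E) (extChartAt 𝓘(ℝ, E) ξ.proj).symm
        (extChartAt 𝓘(ℝ, E) ξ.proj η.proj) w) := by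
  have hx := proj_mem_source_of_mem_source h
  have h3 : (extChartAt (cotangentModel E) ξ η).2 =
      ContinuousLinearMap.inCoordinates E (TangentSpace 𝓘(ℝ, E)) ℝ
        (fun _ : M => ℝ) ξ.proj η.proj ξ.proj η.proj η.2 := by
    rw [FiberBundle.extChartAt]
    simp [hom_trivializationAt_apply]
  rw [h3, ContinuousLinearMap.inCoordinates, TangentBundle.symmL_trivializationAt hx]
  have hr : Set.range (𝓘(ℝ, E)) = Set.univ := by simp
  rw [hr, mfderivWithin_univ]
  simp
  rfl

lemma proj_extChartAt_cotangent_symm {ξ : CotangentBundle E M} {z : E × (E →L[ℝ] ℝ)}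
    (hz : z ∈ (extChartAt (cotangentModel E) ξ).target) :
    ((extChartAt (cotangentModel E) ξ).symm z).proj =
      (extChartAt 𝓘(ℝ, E) ξ.proj).symm z.1 := by
  have hs := (extChartAt (cotangentModel E) ξ).map_target hz
  have hr := (extChartAt (cotangentModel E) ξ).right_inv hz
  have h1 := extChartAt_cotangent_fst ξ ((extChartAt (cotangentModel E) ξ).symm z)
  rw [hr] at h1
  rw [h1, (extChartAt 𝓘(ℝ, E) ξ.proj).left_inv]
  rw [extChartAt_source]
  exact proj_mem_source_of_mem_source hs

/-- In the chart around `ξ` the tautological form is `(u, α) ↦ p u` at the point `(x, p)`. -/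
lemma tautologicalFormInChart_apply (ξ : CotangentBundle E M) {z : E × (E →L[ℝ] ℝ)}
    (hz : z ∈ (extChartAt (cotangentModel E) ξ).target) (v : Fin 1 → E × (E →L[ℝ] ℝ)) :
    tautologicalFormInChart ξ z v = z.2 (v 0).1 := by
  have hs := (extChartAt (cotangentModel E) ξ).map_target hz
  have hr := (extChartAt (cotangentModel E) ξ).right_inv hz
  have h1 := extChartAt_cotangent_fst ξ ((extChartAt (cotangentModel E) ξ).symm z)
  have h2 := extChartAt_cotangent_snd hs (v 0).1
  rw [hr] at h1 h2
  rw [h2, ← h1]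
  have hz1 : z.1 ∈ (extChartAt 𝓘(ℝ, E) ξ.proj).target := by
    rw [h1]
    apply (extChartAt 𝓘(ℝ, E) ξ.proj).map_source
    rw [extChartAt_source]
    exact proj_mem_source_of_mem_source hs
  have hd1 : MDifferentiableAt 𝓘(ℝ, E × (E →L[ℝ] ℝ)) (cotangentModel E)
      (extChartAt (cotangentModel E) ξ).symm z := by
    have := mdifferentiableWithinAt_extChartAt_symm (I := cotangentModel E) hz
    have hu : Set.range (cotangentModel E) = Set.univ := by
      simp
    rwa [hu, mdifferentiableWithinAt_univ] at this
  have hd2 : MDifferentiableAt 𝓘(ℝ, E) 𝓘(ℝ, E) (extChartAt 𝓘(ℝ, E) ξ.proj).symm z.1 := by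
    have := mdifferentiableWithinAt_extChartAt_symm (I := 𝓘(ℝ, E)) hz1
    have hu : Set.range (𝓘(ℝ, E)) = Set.univ := by simp
    rwa [hu, mdifferentiableWithinAt_univ] at this
  have hd3 : MDifferentiableAt (cotangentModel E) 𝓘(ℝ, E)
      (fun η : CotangentBundle E M => η.proj) ((extChartAt (cotangentModel E) ξ).symm z) :=
    (contMDiffAt_proj (n := 1) _).mdifferentiableAt one_ne_zero
  have hd4 : MDifferentiableAt 𝓘(ℝ, E × (E →L[ℝ] ℝ)) 𝓘(ℝ, E)
      (fun y : E × (E →L[ℝ] ℝ) => y.1) z :=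
    (differentiableAt_fst (𝕜 := ℝ)).mdifferentiableAt
  have hc1 := mfderiv_comp z hd3 hd1
  have hc2 := mfderiv_comp z hd2 hd4
  have hev : ((fun η : CotangentBundle E M => η.proj) ∘ (extChartAt (cotangentModel E) ξ).symm)
      =ᶠ[nhds z] (extChartAt 𝓘(ℝ, E) ξ.proj).symm ∘ (fun y : E × (E →L[ℝ] ℝ) => y.1) := by
    have ht : (extChartAt (cotangentModel E) ξ).target ∈ nhds z :=
      (isOpen_extChartAt_target ξ).mem_nhds hz
    filter_upwards [ht] with y hy
    exact proj_extChartAt_cotangent_symm hy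
  have hcc := hev.mfderiv_eq (I := 𝓘(ℝ, E × (E →L[ℝ] ℝ))) (I' := 𝓘(ℝ, E))
  rw [hc1, hc2] at hcc
  have hfst : mfderiv 𝓘(ℝ, E × (E →L[ℝ] ℝ)) 𝓘(ℝ, E) (fun y : E × (E →L[ℝ] ℝ) => y.1) z =
      ContinuousLinearMap.fst ℝ E (E →L[ℝ] ℝ) := by
    rw [mfderiv_eq_fderiv]
    exact fderiv_fst
  have := DFunLike.congr_fun hcc (v 0)
  rw [hfst] at this
  exact congrArg ((extChartAt (cotangentModel E) ξ).symm z).2 this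

/-- The exterior derivative of a 1-form with linear coefficients. -/
lemma extDeriv_linear_apply {V : Type*} [NormedAddCommGroup V] [NormedSpace ℝ V]
    (T : V →L[ℝ] (V →L[ℝ] ℝ)) (z X Y : V) :
    extDeriv (fun z => ContinuousAlternatingMap.ofSubsingleton ℝ V ℝ (0 : Fin 1) (T z)) z ![X, Y] =
      T X Y - T Y X := by
  let J : (V →L[ℝ] ℝ) ≃ₗᵢ[ℝ] (V [⋀^Fin 1]→L[ℝ] ℝ) :=
    ContinuousAlternatingMap.ofSubsingletonLIE (𝕜 := ℝ) (0 : Fin 1)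
  have hd : DifferentiableAt ℝ
      (fun z => ContinuousAlternatingMap.ofSubsingleton ℝ V ℝ (0 : Fin 1) (T z)) z :=
    J.differentiableAt.comp z T.differentiableAt
  rw [extDeriv_apply hd, Fin.sum_univ_two]
  have hT : ∀ (i : Fin 2), (fun z => (ContinuousAlternatingMap.ofSubsingleton ℝ V ℝ (0 : Fin 1)
      (T z)) (i.removeNth ![X, Y])) = (T.flip (i.removeNth ![X, Y] 0)) := fun i => rfl
  rw [hT, hT, ContinuousLinearMap.fderiv, ContinuousLinearMap.fderiv]
  simp [Fin.removeNth]
  ring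

/-- The usual formula `ω((u, α), (w, β)) = β u - α w` for the canonical symplectic form. -/
lemma canonicalSymplecticForm_apply (ξ : CotangentBundle E M) (X Y : E × (E →L[ℝ] ℝ)) :
    canonicalSymplecticForm ξ ![X, Y] = Y.2 X.1 - X.2 Y.1 := by
  let T : (E × (E →L[ℝ] ℝ)) →L[ℝ] ((E × (E →L[ℝ] ℝ)) →L[ℝ] ℝ) :=
    ((ContinuousLinearMap.compL ℝ (E × (E →L[ℝ] ℝ)) E ℝ).flip
      (ContinuousLinearMap.fst ℝ E (E →L[ℝ] ℝ))).comp (ContinuousLinearMap.snd ℝ E (E →L[ℝ] ℝ))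
  have hev : tautologicalFormInChart ξ =ᶠ[nhds (extChartAt (cotangentModel E) ξ ξ)]
      fun z => ContinuousAlternatingMap.ofSubsingleton ℝ (E × (E →L[ℝ] ℝ)) ℝ (0 : Fin 1) (T z) := by
    filter_upwards [extChartAt_target_mem_nhds ξ] with z hz
    ext v
    rw [tautologicalFormInChart_apply ξ hz]
    rfl
  rw [canonicalSymplecticForm, mfderiv_extChartAt_self, hev.extDeriv_eq]
  have h2 := congrArg Neg.neg (extDeriv_linear_apply T (extChartAt (cotangentModel E) ξ ξ) X Y)
  rw [neg_sub] at h2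
  exact h2

/-- The differential `df(ξ)` of a function on `T*M`, as a covector. -/
def differential (f : CotangentBundle E M → ℝ) (ξ : CotangentBundle E M) :
    TangentSpace (cotangentModel E) ξ →L[ℝ] ℝ :=
  mfderiv (cotangentModel E) 𝓘(ℝ, ℝ) f ξ

/-! ### Tonelli Hamiltonians -/

/-- Tonelli Hamiltonians on `T*M`: of class `C²`, strictly convex in each fibre (in the strong sense
of a positive definite fibrewise Hessian), and uniformly superlinear in the fibres: for
every `K` there is `C` with `H(x, p) ≥ K ‖p‖ - C`, where `‖p‖ = sup {p v : ‖v‖ ≤ 1}` is the norm of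
a Riemannian metric of `M` (for compact `M`, which one does not matter). -/
structure IsTonelliHamiltonian (H : CotangentBundle E M → ℝ) : Prop where
  contMDiff : ContMDiff (cotangentModel E) 𝓘(ℝ, ℝ) 2 H
  strictConvex : ∀ x : M, StrictConvexOn ℝ Set.univ
    (fun p : TangentSpace 𝓘(ℝ, E) x →L[ℝ] ℝ => H ⟨x, p⟩)
  hessian_pos : ∀ (x : M) (p q : TangentSpace 𝓘(ℝ, E) x →L[ℝ] ℝ), q ≠ 0 →
    0 < iteratedDeriv 2 (fun t : ℝ => H ⟨x, p + t • q⟩) 0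
  superlinear : ∃ m : ContMDiffRiemannianMetric 𝓘(ℝ, E) ∞ E
      (fun x : M => TangentSpace 𝓘(ℝ, E) x),
    ∀ K : ℝ, 0 ≤ K → ∃ C : ℝ, ∀ (x : M) (p : TangentSpace 𝓘(ℝ, E) x →L[ℝ] ℝ)
      (v : TangentSpace 𝓘(ℝ, E) x), m.inner x v v ≤ 1 → K * p v - C ≤ H ⟨x, p⟩

/-! ### Hamiltonian vector fields, Poisson brackets and integrals of motion -/

variable [FiniteDimensional ℝ E]

/-- The canonical symplectic form is nondegenerate: every covector at `ξ` is `ω(X, ·)` for exactly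
one tangent vector `X`. -/
lemma existsUnique_symplecticGradient (ξ : CotangentBundle E M)
    (l : TangentSpace (cotangentModel E) ξ →L[ℝ] ℝ) :
    ∃! X : TangentSpace (cotangentModel E) ξ,
      ∀ Y : TangentSpace (cotangentModel E) ξ, canonicalSymplecticForm ξ ![X, Y] = l Y := by
  let l' : (E × (E →L[ℝ] ℝ)) →L[ℝ] ℝ := l
  have key : ∃! X : E × (E →L[ℝ] ℝ), ∀ Y : E × (E →L[ℝ] ℝ), Y.2 X.1 - X.2 Y.1 = l' Y := by
    obtain ⟨x, hx⟩ : ∃ x : E, ∀ f : E →L[ℝ] ℝ, f x = l' (0, f) := by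
      let m : Module.Dual ℝ (Module.Dual ℝ E) :=
        { toFun := fun f => l' (0, LinearMap.toContinuousLinearMap f)
          map_add' := by
            intro f g
            rw [← map_add, map_add LinearMap.toContinuousLinearMap]
            simp
          map_smul' := by
            intro c f
            rw [map_smul LinearMap.toContinuousLinearMap]
            have : ((0 : E), c • LinearMap.toContinuousLinearMap f) =
                c • ((0 : E), LinearMap.toContinuousLinearMap f) := by simp
            rw [this, map_smul]
            rfl }
      obtain ⟨x, hx⟩ := (Module.evalEquiv ℝ E).surjective m
      refine ⟨x, fun f => ?_⟩
      exact DFunLike.congr_fun hx (f : E →ₗ[ℝ] ℝ)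
    refine ⟨(x, -(l'.comp (ContinuousLinearMap.inl ℝ E (E →L[ℝ] ℝ)))), ?_, ?_⟩
    · rintro ⟨w, f⟩
      simp only [neg_apply, ContinuousLinearMap.comp_apply,
        ContinuousLinearMap.inl_apply, hx f, sub_neg_eq_add]
      rw [← map_add]
      simp
    · rintro ⟨y, g⟩ hy
      have h1 : ∀ f : E →L[ℝ] ℝ, f y = f x := fun f => by
        rw [hx f]; simpa using hy (0, f)
      have h2 : ∀ w : E, -(g w) = l' (w, 0) := fun w => by simpa using hy (w, 0)
      refine Prod.ext ?_ ?_
      · by_contra hne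
        obtain ⟨f, hf⟩ := SeparatingDual.exists_separating_of_ne (R := ℝ) hne
        exact hf (h1 f)
      · ext w
        simp [← h2 w]
  obtain ⟨X, hX, hu⟩ := key
  refine ⟨X, fun Y => ?_, fun Z hZ => hu Z fun Y => ?_⟩
  · exact (canonicalSymplecticForm_apply ξ X Y).trans (hX Y)
  · exact (canonicalSymplecticForm_apply ξ Z Y).symm.trans (hZ Y)

/-- The Hamiltonian vector field `X_f`, defined by `ω(X_f, ·) = df`. -/
def hamiltonianVectorField (f : CotangentBundle E M → ℝ) (ξ : CotangentBundle E M) :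
    TangentSpace (cotangentModel E) ξ :=
  (existsUnique_symplecticGradient ξ (differential f ξ)).choose

/-- The Poisson bracket `{f, g} = ω(X_f, X_g)`. -/
def poissonBracket (f g : CotangentBundle E M → ℝ) (ξ : CotangentBundle E M) : ℝ :=
  canonicalSymplecticForm ξ ![hamiltonianVectorField f ξ, hamiltonianVectorField g ξ]

/-- `F` is an integral of motion of `H`: a `C¹` function in involution with `H`. -/
def IsIntegralOfMotion (H F : CotangentBundle E M → ℝ) : Prop :=
  ContMDiff (cotangentModel E) 𝓘(ℝ, ℝ) 1 F ∧ ∀ ξ, poissonBracket H F ξ = 0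

/-- The functions `F_i` are integrals of motion of `H`, of class `C²` and independent at each point
of `T*M`, i.e. their differentials are linearly independent at each point. -/
structure AreIndependentIntegrals {ι : Type*} (H : CotangentBundle E M → ℝ)
    (F : ι → CotangentBundle E M → ℝ) : Prop where
  contMDiff : ∀ i, ContMDiff (cotangentModel E) 𝓘(ℝ, ℝ) 2 (F i)
  isIntegralOfMotion : ∀ i, IsIntegralOfMotion H (F i)
  linearIndependent : ∀ ξ, LinearIndependent ℝ (fun i => differential (F i) ξ)

/-- Weak integrability of a `C²` Hamiltonian on `T*M` (`dim T*M = 2 n`, `n = dim E`): there are `n`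
integrals of motion of class `C²` which are independent at each point of `T*M`. -/
def IsWeaklyIntegrable (H : CotangentBundle E M → ℝ) : Prop :=
  ContMDiff (cotangentModel E) 𝓘(ℝ, ℝ) 2 H ∧
    ∃ F : Fin (Module.finrank ℝ E) → CotangentBundle E M → ℝ, AreIndependentIntegrals H F

/-! ### The Hamiltonian of the geodesic flow of a Riemannian metric -/

/-- The operator `A_x : T_x M → T_x* M`, `A_x v = m_x(v, ·)`, of a Riemannian metric `m`. -/
def metricOperator (m : ContMDiffRiemannianMetric 𝓘(ℝ, E) ∞ E
    (fun x : M => TangentSpace 𝓘(ℝ, E) x)) (x : M) :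
    TangentSpace 𝓘(ℝ, E) x ≃ₗ[ℝ] (TangentSpace 𝓘(ℝ, E) x →L[ℝ] ℝ) :=
  LinearEquiv.ofBijective (m.inner x : TangentSpace 𝓘(ℝ, E) x →ₗ[ℝ] _) (by
    have hinj : Function.Injective (m.inner x) := by
      refine (injective_iff_map_eq_zero _).2 fun v hv => ?_
      by_contra hne
      have h := m.pos x v hne
      rw [hv] at h
      exact lt_irrefl _ h
    have hdim : Module.finrank ℝ E = Module.finrank ℝ (E →L[ℝ] ℝ) := by
      rw [← Subspace.dual_finrank_eq (K := ℝ) (V := E)]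
      exact LinearEquiv.finrank_eq LinearMap.toContinuousLinearMap
    have hs := fun A : E →ₗ[ℝ] (E →L[ℝ] ℝ) =>
      LinearMap.injective_iff_surjective_of_finrank_eq_finrank (f := A) hdim
    exact ⟨hinj, (hs _).1 hinj⟩)

/-- The Hamiltonian `H(x, p) = ½ ⟨p, A_x⁻¹ p⟩` of the geodesic flow of a Riemannian metric, i.e.
the Legendre transform of the kinetic energy `L(x, v) = ½ ⟨A_x v, v⟩`. -/
def geodesicHamiltonian (m : ContMDiffRiemannianMetric 𝓘(ℝ, E) ∞ E
    (fun x : M => TangentSpace 𝓘(ℝ, E) x)) (ξ : CotangentBundle E M) : ℝ :=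
  (1 / 2) * ξ.2 ((metricOperator m ξ.proj).symm ξ.2)

end Cotangent

/-! ### Lie groups -/

section LieGroup

variable {E G : Type*} [NormedAddCommGroup E] [NormedSpace ℝ E]
  [TopologicalSpace G] [ChartedSpace E G] [Group G] [LieGroup 𝓘(ℝ, E) ∞ G]

/-- A Riemannian metric on a Lie group is left-invariant if it is preserved by all left
translations `L_g : h ↦ g h`. -/
def IsLeftInvariantMetric (m : ContMDiffRiemannianMetric 𝓘(ℝ, E) ∞ E
    (fun g : G => TangentSpace 𝓘(ℝ, E) g)) : Prop :=
  ∀ (g h : G) (v w : TangentSpace 𝓘(ℝ, E) h),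
    m.inner (g * h) (mfderiv 𝓘(ℝ, E) 𝓘(ℝ, E) (fun x : G => g * x) h v)
      (mfderiv 𝓘(ℝ, E) 𝓘(ℝ, E) (fun x : G => g * x) h w) = m.inner h v w

/-- The angular momentum relative to the space, `p_s = R_g* p ∈ 𝔤*` for `(g, p) ∈ T*G`, where
`R_g : h ↦ h g`; that is, `p_s(a) = p (dR_g a)` for `a ∈ 𝔤 = T_1 G`. -/
def spatialMomentum (ξ : CotangentBundle E G) : GroupLieAlgebra 𝓘(ℝ, E) G →L[ℝ] ℝ :=
  ξ.2.comp (mfderiv 𝓘(ℝ, E) 𝓘(ℝ, E) (fun h : G => h * ξ.proj) (1 : G))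

/-- The component `⟨p_s, a⟩` of the angular momentum relative to the space. -/
def spatialMomentumComponent (a : GroupLieAlgebra 𝓘(ℝ, E) G) (ξ : CotangentBundle E G) : ℝ :=
  spatialMomentum ξ a

end LieGroup

end

/-! Trivialise the tangent bundle of `G` in two ways: by left translations, `dL_g : 𝔤 → T_gG`, and
by right translations, `dR_g`. Pulling `p` back gives the body momentum `L_g* p` and the spatial
momentum `R_g* p`. For a left-invariant metric `H` is a fixed quadratic form `q` of the body
momentum alone (`geodesicHamiltonian_eq_of_isLeftInvariantMetric`), while the components of the
spatial momentum are the functions `p(Y)` with `Y` a right-invariant vector field.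

The bracket of `q(p ∘ L)` with `p(R b)` is `dq` applied to a covector measuring the Lie brackets of
the fields `L a` with `R b` (`poissonBracket_frameMomentum_eq_zero`). These brackets vanish: in
charts both derivatives of the frames are the mixed second derivative of `(u, v) ↦ u x v`, taken in
the two orders (`fderiv_localFrame_leftFrame_rightFrame_comm`).

Independence is visible on vertical vectors, where `dF_i` is evaluation at `dR_g a_i`, and `dR_g` is
injective. The Tonelli conditions hold since `H` is a positive definite quadratic form on each
fibre; its smoothness is read off from `q` and the left frame. -/

noncomputable section

/-! ### Momenta of frames in cotangent charts -/

section Cotangent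

variable {E M A : Type*} [NormedAddCommGroup E] [NormedSpace ℝ E]
  [NormedAddCommGroup A] [NormedSpace ℝ A]
  [TopologicalSpace M] [ChartedSpace E M] [IsManifold 𝓘(ℝ, E) ∞ M]

lemma contMDiffAt_of_eventuallyEq_chart {n : ℕ∞ω} {f : CotangentBundle E M → ℝ}
    {F : E × (E →L[ℝ] ℝ) → ℝ} {ξ : CotangentBundle E M}
    (h : f ∘ (extChartAt (cotangentModel E) ξ).symm
      =ᶠ[nhds (extChartAt (cotangentModel E) ξ ξ)] F)
    (hF : ContDiffAt ℝ n F (extChartAt (cotangentModel E) ξ ξ)) :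
    ContMDiffAt (cotangentModel E) 𝓘(ℝ, ℝ) n f ξ := by
  rw [contMDiffAt_iff_source]
  exact (hF.congr_of_eventuallyEq h).contMDiffAt.contMDiffWithinAt

/-- The manifold derivative at `ξ` is by definition computed in the preferred chart at `ξ`, so no
transition map appears. -/
lemma differential_eq_of_eventuallyEq_chart {f : CotangentBundle E M → ℝ}
    {F : E × (E →L[ℝ] ℝ) → ℝ} {ξ : CotangentBundle E M}
    (h : f ∘ (extChartAt (cotangentModel E) ξ).symm
      =ᶠ[nhds (extChartAt (cotangentModel E) ξ ξ)] F)
    (hF : ContDiffAt ℝ 1 F (extChartAt (cotangentModel E) ξ ξ)) :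
    differential f ξ = fderiv ℝ F (extChartAt (cotangentModel E) ξ ξ) := by
  have hd := (contMDiffAt_of_eventuallyEq_chart h hF).mdifferentiableAt one_ne_zero
  rw [differential, hd.mfderiv]
  have hr : Set.range (cotangentModel E) = Set.univ := by simp
  rw [hr, fderivWithin_univ, ← h.fderiv_eq]
  rfl

/-- The derivative of the preferred chart at its own centre is the identity of `E`, so the covector
is its own fibre coordinate. -/
lemma extChartAt_cotangent_self (ξ : CotangentBundle E M) :
    extChartAt (cotangentModel E) ξ ξ = (extChartAt 𝓘(ℝ, E) ξ.proj ξ.proj, ξ.2) := by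
  refine Prod.ext (extChartAt_cotangent_fst ξ ξ) ?_
  ext w
  rw [extChartAt_cotangent_snd (mem_extChartAt_source ξ)]
  have h := mfderiv_extChartAt_comp_mfderivWithin_extChartAt_symm' (I := 𝓘(ℝ, E))
    (mem_extChartAt_source (I := 𝓘(ℝ, E)) ξ.proj)
  have hr : Set.range (𝓘(ℝ, E)) = Set.univ := by simp
  rw [mfderiv_extChartAt_self, hr, mfderivWithin_univ] at h
  exact congrArg ξ.2 (DFunLike.congr_fun h w)

/-- The expression, in the chart around `x`, of a family `N` of linear maps into the tangent
spaces. -/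
def localFrame (N : ∀ x : M, A →L[ℝ] TangentSpace 𝓘(ℝ, E) x) (x : M) (y : E) : A →L[ℝ] E :=
  (mfderiv 𝓘(ℝ, E) 𝓘(ℝ, E) (extChartAt 𝓘(ℝ, E) x) ((extChartAt 𝓘(ℝ, E) x).symm y)).comp
    (N ((extChartAt 𝓘(ℝ, E) x).symm y))

/-- The pullback of the covector `p` by `N x` at the point `(x, p)`. -/
def frameMomentum (N : ∀ x : M, A →L[ℝ] TangentSpace 𝓘(ℝ, E) x) (ξ : CotangentBundle E M) :
    A →L[ℝ] ℝ :=
  ξ.2.comp (N ξ.proj)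

lemma localFrame_self (N : ∀ x : M, A →L[ℝ] TangentSpace 𝓘(ℝ, E) x) (x : M) :
    localFrame N x (extChartAt 𝓘(ℝ, E) x x) = N x := by
  rw [localFrame, extChartAt_to_inv, mfderiv_extChartAt_self]
  rfl

/-- In the chart around `ξ`, the momentum of a frame at `(y, p)` is `p ∘ N y`. -/
lemma frameMomentum_extChartAt_symm (N : ∀ x : M, A →L[ℝ] TangentSpace 𝓘(ℝ, E) x)
    {ξ : CotangentBundle E M} {z : E × (E →L[ℝ] ℝ)}
    (hz : z ∈ (extChartAt (cotangentModel E) ξ).target) :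
    frameMomentum N ((extChartAt (cotangentModel E) ξ).symm z) =
      z.2.comp (localFrame N ξ.proj z.1) := by
  have hs := (extChartAt (cotangentModel E) ξ).map_target hz
  have hr := (extChartAt (cotangentModel E) ξ).right_inv hz
  have hp := proj_extChartAt_cotangent_symm hz
  set η := (extChartAt (cotangentModel E) ξ).symm z
  have hsrc : η.proj ∈ (extChartAt 𝓘(ℝ, E) ξ.proj).source := by
    rw [extChartAt_source]
    exact proj_mem_source_of_mem_source hs
  ext a
  have h2 := extChartAt_cotangent_snd hs (localFrame N ξ.proj z.1 a)
  rw [hr] at h2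
  have h := mfderivWithin_extChartAt_symm_comp_mfderiv_extChartAt' (I := 𝓘(ℝ, E)) hsrc
  have hu : Set.range (𝓘(ℝ, E)) = Set.univ := by simp
  rw [hu, mfderivWithin_univ] at h
  refine Eq.trans ?_ h2.symm
  rw [localFrame, ← hp]
  exact (congrArg η.2 (DFunLike.congr_fun h (N η.proj a))).symm

lemma frameMomentum_comp_symm_eventuallyEq (N : ∀ x : M, A →L[ℝ] TangentSpace 𝓘(ℝ, E) x)
    (ξ : CotangentBundle E M) (q : (A →L[ℝ] ℝ) → ℝ) :
    (fun η => q (frameMomentum N η)) ∘ (extChartAt (cotangentModel E) ξ).symm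
      =ᶠ[nhds (extChartAt (cotangentModel E) ξ ξ)]
      fun z => q (z.2.comp (localFrame N ξ.proj z.1)) := by
  filter_upwards [extChartAt_target_mem_nhds ξ] with z hz
  exact congrArg q (frameMomentum_extChartAt_symm N hz)

lemma contDiffAt_comp_localFrame {n : ℕ∞ω} {N : ∀ x : M, A →L[ℝ] TangentSpace 𝓘(ℝ, E) x}
    {ξ : CotangentBundle E M}
    (hN : ContDiffAt ℝ n (localFrame N ξ.proj) (extChartAt 𝓘(ℝ, E) ξ.proj ξ.proj)) :
    ContDiffAt ℝ n (fun z : E × (E →L[ℝ] ℝ) => z.2.comp (localFrame N ξ.proj z.1))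
      (extChartAt (cotangentModel E) ξ ξ) := by
  rw [← extChartAt_cotangent_fst] at hN
  exact contDiffAt_snd.clm_comp (hN.comp _ contDiffAt_fst)

lemma contMDiffAt_comp_frameMomentum {n : ℕ∞ω} {N : ∀ x : M, A →L[ℝ] TangentSpace 𝓘(ℝ, E) x}
    {ξ : CotangentBundle E M} {q : (A →L[ℝ] ℝ) → ℝ} (hq : ContDiff ℝ n q)
    (hN : ContDiffAt ℝ n (localFrame N ξ.proj) (extChartAt 𝓘(ℝ, E) ξ.proj ξ.proj)) :
    ContMDiffAt (cotangentModel E) 𝓘(ℝ, ℝ) n (fun η => q (frameMomentum N η)) ξ :=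
  contMDiffAt_of_eventuallyEq_chart (frameMomentum_comp_symm_eventuallyEq N ξ q)
    (hq.contDiffAt.comp _ (contDiffAt_comp_localFrame hN))

/-- The differential of a function of the momentum of a frame. -/
lemma differential_comp_frameMomentum {N : ∀ x : M, A →L[ℝ] TangentSpace 𝓘(ℝ, E) x}
    {ξ : CotangentBundle E M} {q : (A →L[ℝ] ℝ) → ℝ} (hq : ContDiff ℝ 1 q)
    (hN : ContDiffAt ℝ 1 (localFrame N ξ.proj) (extChartAt 𝓘(ℝ, E) ξ.proj ξ.proj))
    (Y : E × (E →L[ℝ] ℝ)) :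
    differential (fun η => q (frameMomentum N η)) ξ Y =
      fderiv ℝ q (frameMomentum N ξ) (Y.2.comp (N ξ.proj : A →L[ℝ] E) +
        (ξ.2 : E →L[ℝ] ℝ).comp
          (fderiv ℝ (localFrame N ξ.proj) (extChartAt 𝓘(ℝ, E) ξ.proj ξ.proj) Y.1)) := by
  have hd := contDiffAt_comp_localFrame hN
  have h1 := differential_eq_of_eventuallyEq_chart (frameMomentum_comp_symm_eventuallyEq N ξ q)
    (hq.contDiffAt.comp _ hd)
  have hN' : HasFDerivAt (localFrame N ξ.proj) (fderiv ℝ (localFrame N ξ.proj)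
      (extChartAt 𝓘(ℝ, E) ξ.proj ξ.proj)) (extChartAt (cotangentModel E) ξ ξ).1 := by
    rw [extChartAt_cotangent_fst]
    exact (hN.differentiableAt one_ne_zero).hasFDerivAt
  -- Product rule for the composition of `p` with the frame: one term varies the covector, the other
  -- the base point.
  have h2 := (hasFDerivAt_snd (𝕜 := ℝ) (p := extChartAt (cotangentModel E) ξ ξ)).clm_comp
    (hN'.comp _ hasFDerivAt_fst)
  have hval : (extChartAt (cotangentModel E) ξ ξ).2.comp
      (localFrame N ξ.proj (extChartAt (cotangentModel E) ξ ξ).1) = frameMomentum N ξ := by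
    rw [extChartAt_cotangent_self, localFrame_self]
    rfl
  have hq' : HasFDerivAt q (fderiv ℝ q (frameMomentum N ξ))
      ((extChartAt (cotangentModel E) ξ ξ).2.comp
      (localFrame N ξ.proj (extChartAt (cotangentModel E) ξ ξ).1)) := by
    rw [hval]
    exact (hq.differentiable one_ne_zero _).hasFDerivAt
  have h3 := (HasFDerivAt.comp (extChartAt (cotangentModel E) ξ ξ)
    (f := fun z => z.2.comp (localFrame N ξ.proj z.1)) hq' h2).fderiv
  have h4 := DFunLike.congr_fun (h1.trans h3) Y
  refine h4.trans ?_
  refine congrArg (fderiv ℝ q (frameMomentum N ξ)) ?_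
  ext a
  have hsnd : (extChartAt (cotangentModel E) ξ ξ).2 = (ξ.2 : E →L[ℝ] ℝ) :=
    congrArg Prod.snd (extChartAt_cotangent_self ξ)
  change (extChartAt (cotangentModel E) ξ ξ).2 (fderiv ℝ (localFrame N ξ.proj)
      (extChartAt 𝓘(ℝ, E) ξ.proj ξ.proj) Y.1 a) +
    Y.2 (localFrame N ξ.proj (extChartAt (cotangentModel E) ξ ξ).1 a) = _
  rw [extChartAt_cotangent_fst, localFrame_self, hsnd, add_comm]
  rfl

/-! ### Hamiltonian vector fields and brackets of momenta -/

variable [FiniteDimensional ℝ E]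

lemma canonicalSymplecticForm_hamiltonianVectorField (f : CotangentBundle E M → ℝ)
    (ξ : CotangentBundle E M) (Y : TangentSpace (cotangentModel E) ξ) :
    canonicalSymplecticForm ξ ![hamiltonianVectorField f ξ, Y] = differential f ξ Y :=
  (existsUnique_symplecticGradient ξ (differential f ξ)).choose_spec.1 Y

lemma poissonBracket_eq_differential (f g : CotangentBundle E M → ℝ) (ξ : CotangentBundle E M) :
    poissonBracket f g ξ = differential f ξ (hamiltonianVectorField g ξ) :=
  canonicalSymplecticForm_hamiltonianVectorField f ξ _

/-- The Hamiltonian vector field of the component `p (N a)` of the momentum of a frame. -/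
lemma hamiltonianVectorField_frameMomentum_apply
    {N : ∀ x : M, A →L[ℝ] TangentSpace 𝓘(ℝ, E) x} {ξ : CotangentBundle E M}
    (hN : ContDiffAt ℝ 1 (localFrame N ξ.proj) (extChartAt 𝓘(ℝ, E) ξ.proj ξ.proj)) (a : A) :
    hamiltonianVectorField (fun η => frameMomentum N η a) ξ =
      ((N ξ.proj a : E), -((ξ.2 : E →L[ℝ] ℝ).comp
        ((fderiv ℝ (localFrame N ξ.proj) (extChartAt 𝓘(ℝ, E) ξ.proj ξ.proj)).flip a))) := by
  -- By nondegeneracy it is enough that the proposed vector represents the differential through `ω`.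
  refine (existsUnique_symplecticGradient ξ
    (differential (fun η => frameMomentum N η a) ξ)).unique
    (fun Y => canonicalSymplecticForm_hamiltonianVectorField _ ξ Y) (fun Y => ?_)
  have hq : ContDiff ℝ 1 (fun l : A →L[ℝ] ℝ => l a) :=
    contDiff_id.clm_apply contDiff_const
  have h1 := differential_comp_frameMomentum (q := fun l : A →L[ℝ] ℝ => l a) hq hN Y
  have h2 : fderiv ℝ (fun l : A →L[ℝ] ℝ => l a) (frameMomentum N ξ) =
      ContinuousLinearMap.apply ℝ ℝ a := (ContinuousLinearMap.apply ℝ ℝ a).fderiv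
  rw [h2] at h1
  refine Eq.trans ?_ h1.symm
  refine (canonicalSymplecticForm_apply ξ _ Y).trans ?_
  simp
  rfl

/-- A function of the momentum of `L` Poisson-commutes with a component of the momentum of `R` if
the vector fields of `L` commute with the corresponding vector field of `R`. -/
lemma poissonBracket_frameMomentum_eq_zero {B : Type*} [NormedAddCommGroup B] [NormedSpace ℝ B]
    {L : ∀ x : M, A →L[ℝ] TangentSpace 𝓘(ℝ, E) x} {R : ∀ x : M, B →L[ℝ] TangentSpace 𝓘(ℝ, E) x}
    {ξ : CotangentBundle E M} {q : (A →L[ℝ] ℝ) → ℝ} (hq : ContDiff ℝ 1 q) (b : B)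
    (hL : ContDiffAt ℝ 1 (localFrame L ξ.proj) (extChartAt 𝓘(ℝ, E) ξ.proj ξ.proj))
    (hR : ContDiffAt ℝ 1 (localFrame R ξ.proj) (extChartAt 𝓘(ℝ, E) ξ.proj ξ.proj))
    (hLR : ∀ a, fderiv ℝ (localFrame L ξ.proj) (extChartAt 𝓘(ℝ, E) ξ.proj ξ.proj)
        (R ξ.proj b : E) a =
      fderiv ℝ (localFrame R ξ.proj) (extChartAt 𝓘(ℝ, E) ξ.proj ξ.proj) (L ξ.proj a : E) b) :
    poissonBracket (fun η => q (frameMomentum L η)) (fun η => frameMomentum R η b) ξ = 0 := by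
  rw [poissonBracket_eq_differential, hamiltonianVectorField_frameMomentum_apply hR b]
  refine (differential_comp_frameMomentum hq hL _).trans ?_
  -- The argument of `dq` is the covector `a ↦ p (DL(R b) a - DR(L a) b)`, a Lie bracket paired with
  -- `p`; it is zero by `hLR`.
  refine (congrArg (fderiv ℝ q (frameMomentum L ξ)) ?_).trans (map_zero _)
  ext a
  have h := congrArg (ξ.2 : E →L[ℝ] ℝ) (hLR a)
  exact neg_add_eq_zero.2 h.symm

end Cotangent

/-! ### Left and right translation frames in charts -/

section LieGroup

variable {E G : Type*} [NormedAddCommGroup E] [NormedSpace ℝ E]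
  [TopologicalSpace G] [ChartedSpace E G] [Group G] [LieGroup 𝓘(ℝ, E) ∞ G]

variable (E) in
/-- The differential at `1` of the left translation by `g`. -/
def leftFrame (g : G) : E →L[ℝ] TangentSpace 𝓘(ℝ, E) g :=
  -- The derivative lands over `g * 1`; since every tangent space is a copy of `E`, the ascription
  -- moves it over `g`.
  (mfderiv 𝓘(ℝ, E) 𝓘(ℝ, E) (fun h : G => g * h) (1 : G) : E →L[ℝ] E)

variable (E) in
/-- The differential at `1` of the right translation by `g`. -/
def rightFrame (g : G) : E →L[ℝ] TangentSpace 𝓘(ℝ, E) g :=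
  (mfderiv 𝓘(ℝ, E) 𝓘(ℝ, E) (fun h : G => h * g) (1 : G) : E →L[ℝ] E)

lemma contMDiffAt_extChartAt_symm' {x : G} {y : E} (hy : y ∈ (extChartAt 𝓘(ℝ, E) x).target) :
    ContMDiffAt 𝓘(ℝ, E) 𝓘(ℝ, E) ∞ (extChartAt 𝓘(ℝ, E) x).symm y :=
  (contMDiffOn_extChartAt_symm x).contMDiffAt ((isOpen_extChartAt_target x).mem_nhds hy)

/-- The differential in the chart at `x` of a map `f` from `G`, read through the chart at `1`. -/
lemma fderiv_extChartAt_comp_comp_symm {x : G} {f : G → G}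
    (hf : MDifferentiableAt 𝓘(ℝ, E) 𝓘(ℝ, E) f 1) (hx : f 1 ∈ (chartAt E x).source) :
    fderiv ℝ (fun u => extChartAt 𝓘(ℝ, E) x (f ((extChartAt 𝓘(ℝ, E) (1 : G)).symm u)))
        (extChartAt 𝓘(ℝ, E) (1 : G) 1) =
      (mfderiv 𝓘(ℝ, E) 𝓘(ℝ, E) (extChartAt 𝓘(ℝ, E) x) (f 1)).comp
        (mfderiv 𝓘(ℝ, E) 𝓘(ℝ, E) f 1) := by
  set u₀ := extChartAt 𝓘(ℝ, E) (1 : G) 1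
  have hu₀ : (extChartAt 𝓘(ℝ, E) (1 : G)).symm u₀ = 1 := extChartAt_to_inv _
  have hc : MDifferentiableAt 𝓘(ℝ, E) 𝓘(ℝ, E) (extChartAt 𝓘(ℝ, E) (1 : G)).symm u₀ :=
    (contMDiffAt_extChartAt_symm' (mem_extChartAt_target (1 : G))).mdifferentiableAt (by simp)
  have hid : mfderiv 𝓘(ℝ, E) 𝓘(ℝ, E) (extChartAt 𝓘(ℝ, E) (1 : G)).symm u₀ =
      ContinuousLinearMap.id ℝ E := by
    have h := mfderiv_extChartAt_comp_mfderivWithin_extChartAt_symm' (I := 𝓘(ℝ, E))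
      (mem_extChartAt_source (I := 𝓘(ℝ, E)) (1 : G))
    have hr : Set.range (𝓘(ℝ, E)) = Set.univ := by simp
    rw [mfderiv_extChartAt_self, hr, mfderivWithin_univ] at h
    exact h
  have hx' : MDifferentiableAt 𝓘(ℝ, E) 𝓘(ℝ, E) (extChartAt 𝓘(ℝ, E) x) (f 1) :=
    mdifferentiableAt_extChartAt hx
  have h1 : HasMFDerivAt 𝓘(ℝ, E) 𝓘(ℝ, E) (fun u => f ((extChartAt 𝓘(ℝ, E) (1 : G)).symm u)) u₀
      ((mfderiv 𝓘(ℝ, E) 𝓘(ℝ, E) f 1).comp (ContinuousLinearMap.id ℝ E)) := by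
    have h := hc.hasMFDerivAt
    rw [hid] at h
    refine HasMFDerivAt.comp (g := f) u₀ ?_ h
    rw [hu₀]
    exact hf.hasMFDerivAt
  have h3 : HasMFDerivAt 𝓘(ℝ, E) 𝓘(ℝ, E) (extChartAt 𝓘(ℝ, E) x)
      (f ((extChartAt 𝓘(ℝ, E) (1 : G)).symm u₀))
      (mfderiv 𝓘(ℝ, E) 𝓘(ℝ, E) (extChartAt 𝓘(ℝ, E) x) (f 1)) := by
    rw [hu₀]
    exact hx'.hasMFDerivAt
  have h2 := HasMFDerivAt.comp (g := extChartAt 𝓘(ℝ, E) x) u₀ h3 h1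
  have h4 := h2.mfderiv
  rw [mfderiv_eq_fderiv] at h4
  exact h4

lemma mdifferentiableAt_mul_left' (g h : G) :
    MDifferentiableAt 𝓘(ℝ, E) 𝓘(ℝ, E) (fun x : G => g * x) h :=
  (contMDiff_mul_left (I := 𝓘(ℝ, E)) (n := ∞)).mdifferentiableAt (by simp)

lemma mdifferentiableAt_mul_right' (g h : G) :
    MDifferentiableAt 𝓘(ℝ, E) 𝓘(ℝ, E) (fun x : G => x * g) h :=
  (contMDiff_mul_right (I := 𝓘(ℝ, E)) (n := ∞)).mdifferentiableAt (by simp)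

/-- This exhibits the frame as a partial derivative of one smooth map of two variables, the product
in charts, so that its regularity in `y` and its derivative become accessible. -/
lemma localFrame_leftFrame {x : G} {y : E} (hy : y ∈ (extChartAt 𝓘(ℝ, E) x).target) :
    localFrame (leftFrame E) x y = fderiv ℝ (fun v => extChartAt 𝓘(ℝ, E) x
      ((extChartAt 𝓘(ℝ, E) x).symm y * (extChartAt 𝓘(ℝ, E) (1 : G)).symm v))
        (extChartAt 𝓘(ℝ, E) (1 : G) 1) := by
  have hx := (extChartAt 𝓘(ℝ, E) x).map_target hy
  rw [extChartAt_source] at hx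
  have h := fderiv_extChartAt_comp_comp_symm (x := x)
    (mdifferentiableAt_mul_left' (E := E) ((extChartAt 𝓘(ℝ, E) x).symm y) 1) (by simpa using hx)
  rw [h, mul_one]
  rfl

lemma localFrame_rightFrame {x : G} {y : E} (hy : y ∈ (extChartAt 𝓘(ℝ, E) x).target) :
    localFrame (rightFrame E) x y = fderiv ℝ (fun v => extChartAt 𝓘(ℝ, E) x
      ((extChartAt 𝓘(ℝ, E) (1 : G)).symm v * (extChartAt 𝓘(ℝ, E) x).symm y))
        (extChartAt 𝓘(ℝ, E) (1 : G) 1) := by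
  have hx := (extChartAt 𝓘(ℝ, E) x).map_target hy
  rw [extChartAt_source] at hx
  have h := fderiv_extChartAt_comp_comp_symm (x := x)
    (mdifferentiableAt_mul_right' (E := E) ((extChartAt 𝓘(ℝ, E) x).symm y) 1) (by simpa using hx)
  rw [h, one_mul]
  rfl

variable (E) in
/-- The map `(u, v) ↦ u x v`, read through the charts at `1` and at `x`. -/
def biTranslation (x : G) (z : E × E) : E :=
  extChartAt 𝓘(ℝ, E) x ((extChartAt 𝓘(ℝ, E) (1 : G)).symm z.1 * x *
    (extChartAt 𝓘(ℝ, E) (1 : G)).symm z.2)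

lemma contDiffAt_extChartAt_mul {x a b : G} {z : E × E}
    (ha : z.1 ∈ (extChartAt 𝓘(ℝ, E) a).target) (hb : z.2 ∈ (extChartAt 𝓘(ℝ, E) b).target)
    (hx : (extChartAt 𝓘(ℝ, E) a).symm z.1 * (extChartAt 𝓘(ℝ, E) b).symm z.2
      ∈ (chartAt E x).source) :
    ContDiffAt ℝ ∞ (fun z : E × E => extChartAt 𝓘(ℝ, E) x
      ((extChartAt 𝓘(ℝ, E) a).symm z.1 * (extChartAt 𝓘(ℝ, E) b).symm z.2)) z := by
  rw [← contMDiffAt_iff_contDiffAt]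
  have h1 : ContMDiffAt 𝓘(ℝ, E × E) 𝓘(ℝ, E) ∞
      (fun z : E × E => (extChartAt 𝓘(ℝ, E) a).symm z.1) z :=
    ContMDiffAt.comp z (contMDiffAt_extChartAt_symm' ha) contDiffAt_fst.contMDiffAt
  have h2 : ContMDiffAt 𝓘(ℝ, E × E) 𝓘(ℝ, E) ∞
      (fun z : E × E => (extChartAt 𝓘(ℝ, E) b).symm z.2) z :=
    ContMDiffAt.comp z (contMDiffAt_extChartAt_symm' hb) contDiffAt_snd.contMDiffAt
  exact ContMDiffAt.comp z (contMDiffAt_extChartAt' (I := 𝓘(ℝ, E)) (n := ∞) hx) (h1.mul h2)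

lemma contDiffAt_biTranslation (x : G) :
    ContDiffAt ℝ ∞ (biTranslation E x)
      (extChartAt 𝓘(ℝ, E) (1 : G) 1, extChartAt 𝓘(ℝ, E) (1 : G) 1) := by
  rw [← contMDiffAt_iff_contDiffAt]
  have h1 : ContMDiffAt 𝓘(ℝ, E × E) 𝓘(ℝ, E) ∞
      (fun z : E × E => (extChartAt 𝓘(ℝ, E) (1 : G)).symm z.1)
      (extChartAt 𝓘(ℝ, E) (1 : G) 1, extChartAt 𝓘(ℝ, E) (1 : G) 1) :=
    ContMDiffAt.comp _ (contMDiffAt_extChartAt_symm' (mem_extChartAt_target _))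
      contDiffAt_fst.contMDiffAt
  have h2 : ContMDiffAt 𝓘(ℝ, E × E) 𝓘(ℝ, E) ∞
      (fun z : E × E => (extChartAt 𝓘(ℝ, E) (1 : G)).symm z.2)
      (extChartAt 𝓘(ℝ, E) (1 : G) 1, extChartAt 𝓘(ℝ, E) (1 : G) 1) :=
    ContMDiffAt.comp _ (contMDiffAt_extChartAt_symm' (mem_extChartAt_target _))
      contDiffAt_snd.contMDiffAt
  refine ContMDiffAt.comp _ (contMDiffAt_extChartAt' (I := 𝓘(ℝ, E)) (n := ∞) ?_)
    ((h1.mul contMDiffAt_const).mul h2)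
  simp only [extChartAt_to_inv, one_mul, mul_one]
  exact mem_chart_source E x

/-- Forming the frames costs one derivative of the product map. -/
lemma two_add_one_le_infty : (2 + 1 : ℕ∞ω) ≤ ∞ :=
  le_trans (by norm_num : (2 + 1 : ℕ∞ω) ≤ 3) ENat.LEInfty.out

lemma contDiffAt_localFrame_leftFrame (x : G) :
    ContDiffAt ℝ 2 (localFrame (leftFrame E) x) (extChartAt 𝓘(ℝ, E) x x) := by
  have h : ContDiffAt ℝ ∞ (Function.uncurry fun y v : E => extChartAt 𝓘(ℝ, E) x
      ((extChartAt 𝓘(ℝ, E) x).symm y * (extChartAt 𝓘(ℝ, E) (1 : G)).symm v))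
      (extChartAt 𝓘(ℝ, E) x x, extChartAt 𝓘(ℝ, E) (1 : G) 1) :=
    contDiffAt_extChartAt_mul (mem_extChartAt_target _) (mem_extChartAt_target _) (by
      simp only [extChartAt_to_inv, mul_one]
      exact mem_chart_source E x)
  refine (ContDiffAt.fderiv (m := 2) h contDiffAt_const two_add_one_le_infty).congr_of_eventuallyEq ?_
  filter_upwards [extChartAt_target_mem_nhds x] with y hy
  exact localFrame_leftFrame hy

lemma contDiffAt_localFrame_rightFrame (x : G) :
    ContDiffAt ℝ 2 (localFrame (rightFrame E) x) (extChartAt 𝓘(ℝ, E) x x) := by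
  have h0 : ContDiffAt ℝ ∞ (fun z : E × E => extChartAt 𝓘(ℝ, E) x
      ((extChartAt 𝓘(ℝ, E) (1 : G)).symm z.1 * (extChartAt 𝓘(ℝ, E) x).symm z.2))
      (extChartAt 𝓘(ℝ, E) (1 : G) 1, extChartAt 𝓘(ℝ, E) x x) :=
    contDiffAt_extChartAt_mul (mem_extChartAt_target _) (mem_extChartAt_target _) (by
      simp only [extChartAt_to_inv, one_mul]
      exact mem_chart_source E x)
  -- The variables are swapped because `ContDiffAt.fderiv` differentiates in the second one and
  -- keeps the first as parameter.
  have h : ContDiffAt ℝ ∞ (Function.uncurry fun y v : E => extChartAt 𝓘(ℝ, E) x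
      ((extChartAt 𝓘(ℝ, E) (1 : G)).symm v * (extChartAt 𝓘(ℝ, E) x).symm y))
      (extChartAt 𝓘(ℝ, E) x x, extChartAt 𝓘(ℝ, E) (1 : G) 1) :=
    ContDiffAt.comp (extChartAt 𝓘(ℝ, E) x x, extChartAt 𝓘(ℝ, E) (1 : G) 1)
      (f := fun z : E × E => (z.2, z.1)) h0 (contDiffAt_snd.prodMk contDiffAt_fst)
  refine (ContDiffAt.fderiv (m := 2) h contDiffAt_const two_add_one_le_infty).congr_of_eventuallyEq ?_
  filter_upwards [extChartAt_target_mem_nhds x] with y hy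
  exact localFrame_rightFrame hy

/-! ### Commutation of left and right translations -/

/-- Mixed second derivatives in terms of partial derivatives. -/
lemma fderiv_fderiv_right_apply {V W F : Type*} [NormedAddCommGroup V] [NormedSpace ℝ V]
    [NormedAddCommGroup W] [NormedSpace ℝ W] [NormedAddCommGroup F] [NormedSpace ℝ F]
    {f : V × W → F} {v₀ : V} {w₀ : W} (hf : ContDiffAt ℝ 2 f (v₀, w₀)) (v : V) (w : W) :
    fderiv ℝ (fun s => fderiv ℝ (fun t => f (s, t)) w₀) v₀ v w =
      fderiv ℝ (fderiv ℝ f) (v₀, w₀) (v, 0) (0, w) := by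
  have hev : (fun s => fderiv ℝ (fun t => f (s, t)) w₀) =ᶠ[nhds v₀]
      fun s => (fderiv ℝ f (s, w₀)).comp (ContinuousLinearMap.inr ℝ V W) := by
    have h1 : ∀ᶠ z in nhds (v₀, w₀), DifferentiableAt ℝ f z :=
      ((hf.of_le (by norm_num : (1 : ℕ∞ω) ≤ 2)).eventually (by simp)).mono
        fun z hz => hz.differentiableAt one_ne_zero
    have h2 : Filter.Tendsto (fun s : V => (s, w₀)) (nhds v₀) (nhds (v₀, w₀)) :=
      Continuous.tendsto (by fun_prop) _
    filter_upwards [h2.eventually h1] with s hs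
    exact (hs.hasFDerivAt.comp w₀ (hasFDerivAt_prodMk_right s w₀)).fderiv
  have hd : HasFDerivAt (fderiv ℝ f) (fderiv ℝ (fderiv ℝ f) (v₀, w₀)) (v₀, w₀) :=
    ((hf.fderiv_right (m := 1) (by norm_num)).differentiableAt one_ne_zero).hasFDerivAt
  have h3 := (HasFDerivAt.comp (g := fderiv ℝ f) v₀ hd
    (hasFDerivAt_prodMk_left v₀ w₀)).clm_comp
    (hasFDerivAt_const (ContinuousLinearMap.inr ℝ V W) v₀)
  rw [hev.fderiv_eq]
  refine (congrArg (fun T : V →L[ℝ] W →L[ℝ] F => T v w) h3.fderiv).trans ?_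
  simp

/-- The iterated partial derivative in the other order: the two slots of the second derivative are
exchanged with respect to `fderiv_fderiv_right_apply`. -/
lemma fderiv_fderiv_left_apply {V W F : Type*} [NormedAddCommGroup V] [NormedSpace ℝ V]
    [NormedAddCommGroup W] [NormedSpace ℝ W] [NormedAddCommGroup F] [NormedSpace ℝ F]
    {f : V × W → F} {v₀ : V} {w₀ : W} (hf : ContDiffAt ℝ 2 f (v₀, w₀)) (v : V) (w : W) :
    fderiv ℝ (fun t => fderiv ℝ (fun s => f (s, t)) v₀) w₀ w v =
      fderiv ℝ (fderiv ℝ f) (v₀, w₀) (0, w) (v, 0) := by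
  have hev : (fun t => fderiv ℝ (fun s => f (s, t)) v₀) =ᶠ[nhds w₀]
      fun t => (fderiv ℝ f (v₀, t)).comp (ContinuousLinearMap.inl ℝ V W) := by
    have h1 : ∀ᶠ z in nhds (v₀, w₀), DifferentiableAt ℝ f z :=
      ((hf.of_le (by norm_num : (1 : ℕ∞ω) ≤ 2)).eventually (by simp)).mono
        fun z hz => hz.differentiableAt one_ne_zero
    have h2 : Filter.Tendsto (fun t : W => (v₀, t)) (nhds w₀) (nhds (v₀, w₀)) :=
      Continuous.tendsto (by fun_prop) _
    filter_upwards [h2.eventually h1] with t ht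
    exact (ht.hasFDerivAt.comp v₀ (hasFDerivAt_prodMk_left v₀ t)).fderiv
  have hd : HasFDerivAt (fderiv ℝ f) (fderiv ℝ (fderiv ℝ f) (v₀, w₀)) (v₀, w₀) :=
    ((hf.fderiv_right (m := 1) (by norm_num)).differentiableAt one_ne_zero).hasFDerivAt
  have h3 := (HasFDerivAt.comp (g := fderiv ℝ f) w₀ hd
    (hasFDerivAt_prodMk_right v₀ w₀)).clm_comp
    (hasFDerivAt_const (ContinuousLinearMap.inl ℝ V W) w₀)
  rw [hev.fderiv_eq]
  refine (congrArg (fun T : W →L[ℝ] V →L[ℝ] F => T w v) h3.fderiv).trans ?_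
  simp

/-- The map `γ(u) = u x` passes through `x` with derivative `dR_x`, and the left frame at `u x` is
the `v`-derivative of `u x v`. The chain rule along `γ` turns the derivative of the frame in the
direction `dR_x b` into a mixed second derivative. -/
lemma fderiv_localFrame_leftFrame_apply (x : G) (a b : E) :
    fderiv ℝ (localFrame (leftFrame E) x) (extChartAt 𝓘(ℝ, E) x x) (rightFrame E x b : E) a =
      fderiv ℝ (fderiv ℝ (biTranslation E x))
        (extChartAt 𝓘(ℝ, E) (1 : G) 1, extChartAt 𝓘(ℝ, E) (1 : G) 1) (b, 0) (0, a) := by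
  set u₀ := extChartAt 𝓘(ℝ, E) (1 : G) 1 with hu₀
  have hu : (extChartAt 𝓘(ℝ, E) (1 : G)).symm u₀ = 1 := extChartAt_to_inv _
  have hΦ : ContDiffAt ℝ 2 (biTranslation E x) (u₀, u₀) :=
    (contDiffAt_biTranslation x).of_le ENat.LEInfty.out
  rw [← fderiv_fderiv_right_apply hΦ]
  set γ : E → E := fun u => extChartAt 𝓘(ℝ, E) x ((extChartAt 𝓘(ℝ, E) (1 : G)).symm u * x)
    with hγdef
  have hγ₀ : γ u₀ = extChartAt 𝓘(ℝ, E) x x := by simp only [hγdef, hu, one_mul]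
  have hsrc : ∀ᶠ u in nhds u₀,
      (extChartAt 𝓘(ℝ, E) (1 : G)).symm u * x ∈ (extChartAt 𝓘(ℝ, E) x).source := by
    have hc : ContinuousAt (fun u => (extChartAt 𝓘(ℝ, E) (1 : G)).symm u * x) u₀ :=
      ((contMDiffAt_extChartAt_symm' (mem_extChartAt_target (1 : G))).mul
        (contMDiffAt_const (c := x))).continuousAt
    refine hc.eventually ?_
    simp only [hu, one_mul]
    exact extChartAt_source_mem_nhds x
  have hγd : HasFDerivAt γ (rightFrame E x : E →L[ℝ] E) u₀ := by
    have h1 : fderiv ℝ γ u₀ = (rightFrame E x : E →L[ℝ] E) := by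
      rw [← localFrame_self (rightFrame E) x, localFrame_rightFrame (mem_extChartAt_target x),
        extChartAt_to_inv]
    rw [← h1]
    have h2 : ContDiffAt ℝ 2 γ u₀ := by
      have h3 := ContDiffAt.comp u₀ (f := fun u : E => (u, u₀)) hΦ (by fun_prop)
      refine h3.congr_of_eventuallyEq (Filter.Eventually.of_forall fun u => ?_)
      simp only [Function.comp_apply, biTranslation, hγdef, hu, mul_one]
    exact (h2.differentiableAt two_ne_zero).hasFDerivAt
  have hev : (fun s => fderiv ℝ (fun t => biTranslation E x (s, t)) u₀) =ᶠ[nhds u₀]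
      localFrame (leftFrame E) x ∘ γ := by
    filter_upwards [hsrc] with u hu'
    rw [Function.comp_apply, localFrame_leftFrame ((extChartAt 𝓘(ℝ, E) x).map_source hu'),
      (extChartAt 𝓘(ℝ, E) x).left_inv hu']
    rfl
  have hl : HasFDerivAt (localFrame (leftFrame E) x)
      (fderiv ℝ (localFrame (leftFrame E) x) (extChartAt 𝓘(ℝ, E) x x)) (γ u₀) := by
    rw [hγ₀]
    exact ((contDiffAt_localFrame_leftFrame x).differentiableAt two_ne_zero).hasFDerivAt
  rw [hev.fderiv_eq, (hl.comp u₀ hγd).fderiv]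
  rfl

lemma fderiv_localFrame_rightFrame_apply (x : G) (a b : E) :
    fderiv ℝ (localFrame (rightFrame E) x) (extChartAt 𝓘(ℝ, E) x x) (leftFrame E x a : E) b =
      fderiv ℝ (fderiv ℝ (biTranslation E x))
        (extChartAt 𝓘(ℝ, E) (1 : G) 1, extChartAt 𝓘(ℝ, E) (1 : G) 1) (0, a) (b, 0) := by
  set u₀ := extChartAt 𝓘(ℝ, E) (1 : G) 1 with hu₀
  have hu : (extChartAt 𝓘(ℝ, E) (1 : G)).symm u₀ = 1 := extChartAt_to_inv _
  have hΦ : ContDiffAt ℝ 2 (biTranslation E x) (u₀, u₀) :=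
    (contDiffAt_biTranslation x).of_le ENat.LEInfty.out
  rw [← fderiv_fderiv_left_apply hΦ]
  set γ : E → E := fun u => extChartAt 𝓘(ℝ, E) x (x * (extChartAt 𝓘(ℝ, E) (1 : G)).symm u)
    with hγdef
  have hγ₀ : γ u₀ = extChartAt 𝓘(ℝ, E) x x := by simp only [hγdef, hu, mul_one]
  have hsrc : ∀ᶠ u in nhds u₀,
      x * (extChartAt 𝓘(ℝ, E) (1 : G)).symm u ∈ (extChartAt 𝓘(ℝ, E) x).source := by
    have hc : ContinuousAt (fun u => x * (extChartAt 𝓘(ℝ, E) (1 : G)).symm u) u₀ :=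
      ((contMDiffAt_const (c := x)).mul
        (contMDiffAt_extChartAt_symm' (mem_extChartAt_target (1 : G)))).continuousAt
    refine hc.eventually ?_
    simp only [hu, mul_one]
    exact extChartAt_source_mem_nhds x
  have hγd : HasFDerivAt γ (leftFrame E x : E →L[ℝ] E) u₀ := by
    have h1 : fderiv ℝ γ u₀ = (leftFrame E x : E →L[ℝ] E) := by
      rw [← localFrame_self (leftFrame E) x, localFrame_leftFrame (mem_extChartAt_target x),
        extChartAt_to_inv]
    rw [← h1]
    have h2 : ContDiffAt ℝ 2 γ u₀ := by
      have h3 := ContDiffAt.comp u₀ (f := fun u : E => (u₀, u)) hΦ (by fun_prop)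
      refine h3.congr_of_eventuallyEq (Filter.Eventually.of_forall fun u => ?_)
      simp only [Function.comp_apply, biTranslation, hγdef, hu, one_mul]
    exact (h2.differentiableAt two_ne_zero).hasFDerivAt
  have hev : (fun t => fderiv ℝ (fun s => biTranslation E x (s, t)) u₀) =ᶠ[nhds u₀]
      localFrame (rightFrame E) x ∘ γ := by
    filter_upwards [hsrc] with u hu'
    rw [Function.comp_apply, localFrame_rightFrame ((extChartAt 𝓘(ℝ, E) x).map_source hu'),
      (extChartAt 𝓘(ℝ, E) x).left_inv hu']
    -- Associativity enters here: `(u x) v` must be read as the right translate of `u` by `x v`.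
    simp only [biTranslation, mul_assoc]
    rfl
  have hl : HasFDerivAt (localFrame (rightFrame E) x)
      (fderiv ℝ (localFrame (rightFrame E) x) (extChartAt 𝓘(ℝ, E) x x)) (γ u₀) := by
    rw [hγ₀]
    exact ((contDiffAt_localFrame_rightFrame x).differentiableAt two_ne_zero).hasFDerivAt
  rw [hev.fderiv_eq, (hl.comp u₀ hγd).fderiv]
  rfl

/-- Left-invariant and right-invariant vector fields commute. -/
lemma fderiv_localFrame_leftFrame_rightFrame_comm (x : G) (a b : E) :
    fderiv ℝ (localFrame (leftFrame E) x) (extChartAt 𝓘(ℝ, E) x x) (rightFrame E x b : E) a =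
      fderiv ℝ (localFrame (rightFrame E) x) (extChartAt 𝓘(ℝ, E) x x)
        (leftFrame E x a : E) b := by
  rw [fderiv_localFrame_leftFrame_apply, fderiv_localFrame_rightFrame_apply]
  have hΦ : ContDiffAt ℝ 2 (biTranslation E x)
      (extChartAt 𝓘(ℝ, E) (1 : G) 1, extChartAt 𝓘(ℝ, E) (1 : G) 1) :=
    (contDiffAt_biTranslation x).of_le ENat.LEInfty.out
  -- Symmetry of the second derivative of `(u, v) ↦ u x v`.
  exact hΦ.isSymmSndFDerivAt (by simp) _ _

end LieGroup

/-! ### Fibrewise convexity and superlinearity -/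

section Cotangent

variable {E M : Type*} [NormedAddCommGroup E] [NormedSpace ℝ E]
  [TopologicalSpace M] [ChartedSpace E M] [IsManifold 𝓘(ℝ, E) ∞ M] [FiniteDimensional ℝ E]
  (m : ContMDiffRiemannianMetric 𝓘(ℝ, E) ∞ E (fun x : M => TangentSpace 𝓘(ℝ, E) x))

lemma metricOperator_apply (x : M) (v w : TangentSpace 𝓘(ℝ, E) x) :
    metricOperator m x v w = m.inner x v w := rfl

lemma apply_metricOperator_symm (x : M) (p q : TangentSpace 𝓘(ℝ, E) x →L[ℝ] ℝ) :
    p ((metricOperator m x).symm q) =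
      m.inner x ((metricOperator m x).symm p) ((metricOperator m x).symm q) := by
  rw [← metricOperator_apply, LinearEquiv.apply_symm_apply]

lemma apply_metricOperator_symm_comm (x : M) (p q : TangentSpace 𝓘(ℝ, E) x →L[ℝ] ℝ) :
    p ((metricOperator m x).symm q) = q ((metricOperator m x).symm p) := by
  rw [apply_metricOperator_symm, m.symm, ← apply_metricOperator_symm]

lemma apply_metricOperator_symm_self_pos (x : M) {p : TangentSpace 𝓘(ℝ, E) x →L[ℝ] ℝ}
    (hp : p ≠ 0) : 0 < p ((metricOperator m x).symm p) := by
  rw [apply_metricOperator_symm]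
  exact m.pos x _ (by simpa using hp)

lemma geodesicHamiltonian_add_smul (x : M) (p q : TangentSpace 𝓘(ℝ, E) x →L[ℝ] ℝ) (t : ℝ) :
    geodesicHamiltonian m ⟨x, p + t • q⟩ = (1 / 2) * p ((metricOperator m x).symm p) +
      t * p ((metricOperator m x).symm q) + t ^ 2 * ((1 / 2) * q ((metricOperator m x).symm q)) := by
  have h := apply_metricOperator_symm_comm m x q p
  simp only [geodesicHamiltonian, map_add, map_smul, add_apply, smul_apply, smul_eq_mul, h]
  ring

lemma strictConvexOn_geodesicHamiltonian (x : M) : StrictConvexOn ℝ Set.univ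
    (fun p : TangentSpace 𝓘(ℝ, E) x →L[ℝ] ℝ => geodesicHamiltonian m ⟨x, p⟩) := by
  refine ⟨convex_univ, fun p _ q _ hpq a b ha hb hab => ?_⟩
  have hpos := apply_metricOperator_symm_self_pos m x (sub_ne_zero.2 hpq)
  have h := apply_metricOperator_symm_comm m x q p
  have hb' : b = 1 - a := by linarith
  subst hb'
  -- For a quadratic form and `a + b = 1`, the convexity defect `a H(p) + b H(q) - H(a p + b q)`
  -- equals `a b H(p - q)`.
  have key := mul_pos (mul_pos ha hb) hpos
  simp only [geodesicHamiltonian, map_add, map_sub, map_smul, add_apply, sub_apply, smul_apply,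
    smul_eq_mul, h] at key ⊢
  linarith

lemma iteratedDeriv_two_quadratic (a b c : ℝ) :
    iteratedDeriv 2 (fun t : ℝ => a + t * b + t ^ 2 * c) 0 = 2 * c := by
  have h1 : deriv (fun t : ℝ => a + t * b + t ^ 2 * c) = fun t => b + 2 * t * c := by
    ext t
    have := (((hasDerivAt_id t).mul_const b).const_add a).add ((hasDerivAt_pow 2 t).mul_const c)
    refine Eq.trans this.deriv ?_
    simp
  rw [iteratedDeriv_succ, iteratedDeriv_one, h1]
  have := (((hasDerivAt_id (0 : ℝ)).const_mul 2).mul_const c).const_add b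
  refine Eq.trans this.deriv ?_
  ring

/-- Complete the square: with `w = A⁻¹ p`, expanding `0 ≤ |w - K v|²` and using `|v| ≤ 1` gives `K
p(v) ≤ ½ |w|² + ½ K²`. The constant `K² / 2` depends on neither `x` nor `p`. -/
lemma superlinear_geodesicHamiltonian (K : ℝ) (x : M) (p : TangentSpace 𝓘(ℝ, E) x →L[ℝ] ℝ)
    (v : TangentSpace 𝓘(ℝ, E) x) (hv : m.inner x v v ≤ 1) :
    K * p v - K ^ 2 / 2 ≤ geodesicHamiltonian m ⟨x, p⟩ := by
  set w := (metricOperator m x).symm p with hw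
  have hp : ∀ u, p u = m.inner x w u := fun u => by
    rw [← metricOperator_apply, hw, LinearEquiv.apply_symm_apply]
  have hnn : 0 ≤ m.inner x (w - K • v) (w - K • v) := by
    by_cases h : w - K • v = 0
    · simp [h]
    · exact (m.pos x _ h).le
  have hs : m.inner x v w = m.inner x w v := m.symm x v w
  have hH : geodesicHamiltonian m ⟨x, p⟩ = 1 / 2 * m.inner x w w := by
    rw [← hp w]; rfl
  rw [hH, hp v]
  simp only [map_sub, map_smul, sub_apply, smul_apply, smul_eq_mul, hs] at hnn
  nlinarith [mul_le_mul_of_nonneg_left hv (sq_nonneg K)]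

end Cotangent

/-! ### Spatial momentum and left-invariant Hamiltonians -/

section LieGroup

variable {E G : Type*} [NormedAddCommGroup E] [NormedSpace ℝ E]
  [TopologicalSpace G] [ChartedSpace E G] [Group G] [LieGroup 𝓘(ℝ, E) ∞ G]

/-- The derivative of right translation by `g⁻¹` is a left inverse. -/
lemma injective_rightFrame (g : G) : Function.Injective (rightFrame E g) := by
  have h1 := mdifferentiableAt_mul_right' (E := E) g 1
  have h2 := mdifferentiableAt_mul_right' (E := E) g⁻¹ (1 * g)
  have h3 := mfderiv_comp (1 : G) h2 h1
  have hid : (fun x : G => x * g⁻¹) ∘ (fun x : G => x * g) = id := by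
    ext x; simp
  rw [hid, mfderiv_id] at h3
  intro a b hab
  have ha := DFunLike.congr_fun h3 a
  have hb := DFunLike.congr_fun h3 b
  refine ha.trans (Eq.trans ?_ hb.symm)
  exact congrArg (mfderiv 𝓘(ℝ, E) 𝓘(ℝ, E) (fun x : G => x * g⁻¹) (1 * g)) hab

lemma contMDiff_spatialMomentumComponent (a : GroupLieAlgebra 𝓘(ℝ, E) G) :
    ContMDiff (cotangentModel E) 𝓘(ℝ, ℝ) 2
      (spatialMomentumComponent a : CotangentBundle E G → ℝ) := fun ξ =>
  let v : E := a
  contMDiffAt_comp_frameMomentum (N := rightFrame E) (q := fun l : E →L[ℝ] ℝ => l v)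
    (contDiff_id.clm_apply contDiff_const) (contDiffAt_localFrame_rightFrame ξ.proj)

/-- A vanishing combination of the differentials, tested on the vertical vectors `(0, α)`, says that
every `α` kills `dR_g (∑ c_i a_i)`. Hence this vector is zero, and injectivity of `dR_g` gives `c =
0`. -/
lemma linearIndependent_differential_spatialMomentumComponent
    (b : Module.Basis (Fin (Module.finrank ℝ E)) ℝ (GroupLieAlgebra 𝓘(ℝ, E) G))
    (ξ : CotangentBundle E G) :
    LinearIndependent ℝ (fun i => differential (spatialMomentumComponent (b i)) ξ) := by
  rw [Fintype.linearIndependent_iff]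
  intro c hc
  have hval : ∀ (i) (α : E →L[ℝ] ℝ),
      differential (spatialMomentumComponent (b i)) ξ ((0 : E), α) =
        α (rightFrame E ξ.proj (b i) : E) := fun i α => by
    let a : E := b i
    have hq : ContDiff ℝ 1 (fun l : E →L[ℝ] ℝ => l a) :=
      contDiff_id.clm_apply contDiff_const
    have h1 := differential_comp_frameMomentum (ξ := ξ) (q := fun l : E →L[ℝ] ℝ => l a) hq
      ((contDiffAt_localFrame_rightFrame ξ.proj).of_le one_le_two) ((0 : E), α)
    have h2 : fderiv ℝ (fun l : E →L[ℝ] ℝ => l a) (frameMomentum (rightFrame E) ξ) =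
      ContinuousLinearMap.apply ℝ ℝ a := (ContinuousLinearMap.apply ℝ ℝ a).fderiv
    rw [h2] at h1
    refine h1.trans ?_
    simp only [map_zero]
    exact add_eq_left.2 (map_zero (ξ.2 : E →L[ℝ] ℝ))
  let e : Fin (Module.finrank ℝ E) → E := fun i => b i
  let Λ : E →L[ℝ] E := rightFrame E ξ.proj
  have hsum : ∑ i, c i • e i = 0 := by
    refine (injective_iff_map_eq_zero Λ).1 (injective_rightFrame ξ.proj) _ ?_
    by_contra hne
    obtain ⟨α, hα⟩ := SeparatingDual.exists_ne_zero (R := ℝ) (V := E) hne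
    apply hα
    have h := DFunLike.congr_fun hc ((0 : E), α)
    simp only [map_sum, map_smul]
    refine Eq.trans ?_ h
    refine Eq.trans ?_ (sum_apply _ _ _).symm
    refine Finset.sum_congr rfl fun i _ => ?_
    exact congrArg (c i • ·) (hval i α).symm
  exact fun i => Fintype.linearIndependent_iff.1 b.linearIndependent c hsum i

variable [FiniteDimensional ℝ E]

/-- A left-invariant geodesic Hamiltonian is a quadratic form in the body momentum. -/
lemma geodesicHamiltonian_eq_of_isLeftInvariantMetric
    {m : ContMDiffRiemannianMetric 𝓘(ℝ, E) ∞ E (fun g : G => TangentSpace 𝓘(ℝ, E) g)}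
    (hm : IsLeftInvariantMetric m) {T : (E →L[ℝ] ℝ) → E}
    (hT : ∀ (l : E →L[ℝ] ℝ) (v : E), m.inner 1 (T l) v = l v) :
    geodesicHamiltonian m = fun ξ => (1 / 2) * frameMomentum (leftFrame E) ξ
      (T (frameMomentum (leftFrame E) ξ)) := by
  ext ξ
  have hinv : ∀ v w : E, m.inner ξ.proj (leftFrame E ξ.proj v) (leftFrame E ξ.proj w) =
      m.inner 1 v w := fun v w => by
    have h := hm ξ.proj 1 v w
    rw [← h]
    -- Invariance speaks of the metric at `ξ.proj * 1`, which is only propositionally `ξ.proj`; a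
    -- free base point allows substitution.
    have : ∀ (g : G), ξ.proj = g → m.inner ξ.proj (leftFrame E ξ.proj v) (leftFrame E ξ.proj w) =
      m.inner g (leftFrame E ξ.proj v : E) (leftFrame E ξ.proj w : E) := by
      rintro g rfl; rfl
    exact this _ (mul_one _).symm
  -- The left frame is an isometry from `𝔤`, hence injective, and bijective by dimension.
  have hinj : Function.Injective (leftFrame E ξ.proj) := by
    refine (injective_iff_map_eq_zero _).2 fun v hv => ?_
    by_contra hne
    have h := m.pos 1 v hne
    have h' := hinv v v
    rw [hv] at h'
    simp only [map_zero] at h'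
    exact h.ne h'
  let Λ : E →L[ℝ] E := leftFrame E ξ.proj
  have hsurj : Function.Surjective (leftFrame E ξ.proj) :=
    LinearMap.injective_iff_surjective (f := (Λ : E →ₗ[ℝ] E)).1 hinj
  have hsymm : (metricOperator m ξ.proj).symm ξ.2 = leftFrame E ξ.proj
      (T (frameMomentum (leftFrame E) ξ)) := by
    rw [LinearEquiv.symm_apply_eq]
    ext u
    obtain ⟨w, rfl⟩ := hsurj u
    rw [metricOperator_apply, hinv, hT]
    rfl
  rw [geodesicHamiltonian, hsymm]
  rfl

/-- The form is `q(l) = ½ l(A₁⁻¹ l)`, with `A₁` the metric operator at the identity. All dependence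
on the base point sits in the frame, so smoothness of `x ↦ A_x⁻¹` need not be studied. -/
lemma exists_contDiff_geodesicHamiltonian_eq
    {m : ContMDiffRiemannianMetric 𝓘(ℝ, E) ∞ E (fun g : G => TangentSpace 𝓘(ℝ, E) g)}
    (hm : IsLeftInvariantMetric m) :
    ∃ q : (E →L[ℝ] ℝ) → ℝ, ContDiff ℝ 2 q ∧
      geodesicHamiltonian m = fun ξ => q (frameMomentum (leftFrame E) ξ) := by
  let A : E ≃ₗ[ℝ] (E →L[ℝ] ℝ) := metricOperator m 1
  let T : (E →L[ℝ] ℝ) →L[ℝ] E := LinearMap.toContinuousLinearMap (A.symm : (E →L[ℝ] ℝ) →ₗ[ℝ] E)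
  refine ⟨fun l => (1 / 2) * l (T l), contDiff_const.mul (contDiff_id.clm_apply T.contDiff),
    geodesicHamiltonian_eq_of_isLeftInvariantMetric hm (T := T) fun l v => ?_⟩
  exact DFunLike.congr_fun (A.apply_symm_apply l) v

lemma isTonelliHamiltonian_geodesicHamiltonian
    {m : ContMDiffRiemannianMetric 𝓘(ℝ, E) ∞ E (fun g : G => TangentSpace 𝓘(ℝ, E) g)}
    (hm : IsLeftInvariantMetric m) : IsTonelliHamiltonian (geodesicHamiltonian m) where
  contMDiff := by
    obtain ⟨q, hq, hH⟩ := exists_contDiff_geodesicHamiltonian_eq hm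
    rw [hH]
    exact fun ξ => contMDiffAt_comp_frameMomentum hq (contDiffAt_localFrame_leftFrame ξ.proj)
  strictConvex := strictConvexOn_geodesicHamiltonian m
  hessian_pos x p q hq := by
    simp only [geodesicHamiltonian_add_smul]
    rw [iteratedDeriv_two_quadratic]
    linarith [apply_metricOperator_symm_self_pos m x hq]
  superlinear := ⟨m, fun K _ => ⟨K ^ 2 / 2, superlinear_geodesicHamiltonian m K⟩⟩

lemma poissonBracket_geodesicHamiltonian_spatialMomentumComponent
    {m : ContMDiffRiemannianMetric 𝓘(ℝ, E) ∞ E (fun g : G => TangentSpace 𝓘(ℝ, E) g)}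
    (hm : IsLeftInvariantMetric m) (a : GroupLieAlgebra 𝓘(ℝ, E) G) (ξ : CotangentBundle E G) :
    poissonBracket (geodesicHamiltonian m) (spatialMomentumComponent a) ξ = 0 := by
  obtain ⟨q, hq, hH⟩ := exists_contDiff_geodesicHamiltonian_eq hm
  let v : E := a
  have ha : (spatialMomentumComponent a : CotangentBundle E G → ℝ) =
      fun η => frameMomentum (rightFrame E) η v := rfl
  rw [hH, ha]
  exact poissonBracket_frameMomentum_eq_zero (hq.of_le one_le_two) v
    ((contDiffAt_localFrame_leftFrame ξ.proj).of_le one_le_two)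
    ((contDiffAt_localFrame_rightFrame ξ.proj).of_le one_le_two)
    (fun w => fderiv_localFrame_leftFrame_rightFrame_comm ξ.proj w v)

lemma areIndependentIntegrals_spatialMomentumComponent
    {m : ContMDiffRiemannianMetric 𝓘(ℝ, E) ∞ E (fun g : G => TangentSpace 𝓘(ℝ, E) g)}
    (hm : IsLeftInvariantMetric m)
    (b : Module.Basis (Fin (Module.finrank ℝ E)) ℝ (GroupLieAlgebra 𝓘(ℝ, E) G)) :
    AreIndependentIntegrals (geodesicHamiltonian m) (fun i => spatialMomentumComponent (b i)) where
  contMDiff i := contMDiff_spatialMomentumComponent (b i)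
  isIntegralOfMotion i := ⟨(contMDiff_spatialMomentumComponent (b i)).of_le one_le_two,
    poissonBracket_geodesicHamiltonian_spatialMomentumComponent hm (b i)⟩
  linearIndependent := linearIndependent_differential_spatialMomentumComponent b

end LieGroup

end

theorem propositionA1 {E G : Type*} [NormedAddCommGroup E] [NormedSpace ℝ E]
    [FiniteDimensional ℝ E] [TopologicalSpace G] [CompactSpace G] [ChartedSpace E G] [Group G]
    [LieGroup 𝓘(ℝ, E) ∞ G]
    (m : ContMDiffRiemannianMetric 𝓘(ℝ, E) ∞ E (fun g : G => TangentSpace 𝓘(ℝ, E) g))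
    (hm : IsLeftInvariantMetric m) :
    IsTonelliHamiltonian (geodesicHamiltonian m) ∧
      IsWeaklyIntegrable (geodesicHamiltonian m) ∧
      ∀ b : Module.Basis (Fin (Module.finrank ℝ E)) ℝ (GroupLieAlgebra 𝓘(ℝ, E) G),
        AreIndependentIntegrals (geodesicHamiltonian m)
          (fun i => spatialMomentumComponent (b i)) := by
  have hT := isTonelliHamiltonian_geodesicHamiltonian hm
  refine ⟨hT, ⟨hT.contMDiff, ?_⟩, areIndependentIntegrals_spatialMomentumComponent hm⟩
  -- The Lie algebra is `T_1 G`, a copy of `E`, so any basis of `E` serves.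
  exact ⟨_, areIndependentIntegrals_spatialMomentumComponent hm (Module.finBasis ℝ E)⟩
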